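/- **Setting.** Let $(\mathcal X,\Sigma_{\mathcal X})$ be a measurable space, $\mathcal A$ a real Hilbert space with its Borel $\sigma$-algebra, $A:\mathcal X\to\mathcal A$ a measurable map with $\sup_{x}\|A(x)\|_{\mathcal A}<\infty$, and $a\in\mathcal A$. Let $\phi:[0,\infty)\to[0,\infty)$ be decreasing (not necessarily strictly), continuous at $0$, with $\phi(0)=1$, $\lim_{r\to\infty}\phi(r)=0$ and $\phi(r)>0$ for all $r\ge 0$. Let $\mathcal F$ be a normed space of measurable functions $f:\mathcal X\to\mathbb R$ such that $\|f\|_\infty\le C_{\mathcal F}\|f\|_{\mathcal F}$ for a constant $C_{\mathcal F}$ and all $f\in\mathcal F$. Let $m\ge 0$ and $\infty=\delta_0>\delta_1>\dots>\delta_m>0$, and let $\epsilon_0,\dots,\epsilon_{m-1}>0$. For a probability measure $\mu$ on $\mathcal X$ and $\delta\in\{\delta_i\}_{i=0}^m$ put $$\mu_\delta^a(\mathrm dx)=\frac1{Z_\delta^a}\,\phi\!\left(\frac{\|A(x)-a\|_{\mathcal A}}{\delta}\right)\mu(\mathrm dx),\qquad Z_\delta^a=\int\phi\!\left(\frac{\|\tilde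 a-a\|_{\mathcal A}}{\delta}\right)(A_\#\mu)(\mathrm d\tilde a),$$ so that $\mu^a_{\delta_0}=\mu$. Let $K_1,\dots,K_m$ be Markov transition kernels on $\mathcal X$ such that, for all $i=0,\dots,m-1$ and all $x,y\in\mathcal X$, $K_{i+1}(x,\cdot)\ll K_{i+1}(y,\cdot)$ and $$\frac{\mathrm dK_{i+1}(x,\cdot)}{\mathrm dK_{i+1}(y,\cdot)}\ge\epsilon_i\qquad K_{i+1}(y,\cdot)\text{-almost everywhere}.$$ **SMC-ND.** Given $P\ge1$, draw $x_1^0,\dots,x_P^0$ independently from $\mu$. Iteration $i=1,\dots,m$ turns $(x_j^{i-1})_{j=1}^P$ into $(x_j^{i})_{j=1}^P$ by the steps - *Move*: independently for each $j$, replace the current particle $x_j$ by a draw from $K_i(x_j,\cdot)$; - *Re-weight*: give the current particle $x_j$ the weight $w_j=\phi(\delta_i^{-1}\|A(x_j)-a\|_{\mathcal A})/\phi(\delta_{i-1}^{-1}\|A(x_j)-a\|_{\mathcal A})$, where $\infty^{-1}=0$; - *Re-sample*: replace the particles by $P$ conditionally independent draws from the discrete distribution with mass proportional to $w_j$ on $x_j$.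 The steps are taken either (a) in the order Move, Re-weight, Re-sample, where $K_i$ leaves $\mu^a_{\delta_{i-1}}$ invariant for $i=1,\dots,m$; or (b) in the order Re-weight, Re-sample, Move, where $K_i$ leaves $\mu^a_{\delta_i}$ invariant for $i=1,\dots,m$. Put $\mu^a_{\delta_i,P}(f)=\frac1P\sum_{j=1}^Pf(x_j^i)$ for $i=0,\dots,m$. **Theorem.** In the setting above, for every $p\ge1$ there is a constant $C_p$, which may depend on $p$, $\{\delta_i\}$, $\{\epsilon_i\}$ and on $A,a,\phi,\mathcal F, C_{\mathcal F}$, but not on $P$, $\mu$, $f$ or the kernels, such that for all $\mu$ and $K_1,\dots,K_m$ as above, in case (a) as well as in case (b), $$\mathbb E\left[\left|\mu^a_{\delta,P}(f)-\mu^a_\delta(f)\right|^p\right]^{1/p}\le\frac{C_p\,\|f\|_{\mathcal F}}{\sqrt P}\qquad\text{for all }\delta\in\{\delta_i\}_{i=0}^m,\ P\ge1,\ f\in\mathcal F .$$ -/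

import Mathlib

open MeasureTheory ProbabilityTheory Filter Topology
open scoped NNReal ENNReal

noncomputable section

namespace SMCND

/-- A relaxation function `φ : ℝ₊ → ℝ₊`: decreasing, continuous at `0`, with `φ 0 = 1` and
`φ r → 0` as `r → ∞`. -/
structure IsRelaxation (φ : ℝ≥0 → ℝ≥0) : Prop where
  antitone : Antitone φ
  continuousAt_zero : ContinuousAt φ 0
  map_zero : φ 0 = 1
  tendsto_zero : Tendsto φ atTop (𝓝 0)

section Relaxed

variable {𝓐 : Type*} [NormedAddCommGroup 𝓐]

/-- `φ (‖b - a‖ / δ)` for a bandwidth `δ ∈ (0, ∞]`; for `δ = ∞` this is `φ 0`. -/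
def weight (φ : ℝ≥0 → ℝ≥0) (a : 𝓐) (δ : ℝ≥0∞) (b : 𝓐) : ℝ≥0 :=
  φ ((δ⁻¹).toNNReal * ‖b - a‖₊)

variable {X : Type*} [MeasurableSpace X] [MeasurableSpace 𝓐]

/-- The normalisation constant `Z = ∫ φ (‖b - a‖ / δ) (A_# μ)(db)`. -/
def normConst (φ : ℝ≥0 → ℝ≥0) (A : X → 𝓐) (a : 𝓐) (μ : Measure X) (δ : ℝ≥0∞) : ℝ≥0∞ :=
  ∫⁻ b, (weight φ a δ b : ℝ≥0∞) ∂(μ.map A)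

/-- The relaxed distribution `μ_δ^a (dx) = Z⁻¹ φ (‖A x - a‖ / δ) μ(dx)`. -/
def relaxed (φ : ℝ≥0 → ℝ≥0) (A : X → 𝓐) (a : 𝓐) (μ : Measure X) (δ : ℝ≥0∞) : Measure X :=
  (normConst φ A a μ δ)⁻¹ • μ.withDensity (fun x => (weight φ a δ (A x) : ℝ≥0∞))

/-- The re-weighting factor `φ (‖A x - a‖ / δ') / φ (‖A x - a‖ / δ)` used in passing from
bandwidth `δ` to bandwidth `δ'`. -/
def potential (φ : ℝ≥0 → ℝ≥0) (A : X → 𝓐) (a : 𝓐) (δ δ' : ℝ≥0∞) (x : X) : ℝ≥0 :=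
  weight φ a δ' (A x) / weight φ a δ (A x)

end Relaxed

section Particles

variable {X : Type*} [MeasurableSpace X] {P : ℕ}

/-- `Discrete({x_j}; {w_j})`: mass proportional to `w_j` on the state `x_j`. -/
def discrete (x : Fin P → X) (w : Fin P → ℝ≥0) : Measure X :=
  ∑ j, ((w j / ∑ k, w k : ℝ≥0) : ℝ≥0∞) • Measure.dirac (x j)

/-- The empirical distribution `P⁻¹ ∑ⱼ δ(x_j)`. -/
def empirical (x : Fin P → X) : Measure X :=
  (P : ℝ≥0∞)⁻¹ • ∑ j, Measure.dirac (x j)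

/-- Law of the particles after a Move step: given the present particles `x`, the new particles
are independent, the `j`-th one drawn from `κ (x j)`. Here `ν` is the law of `x`. -/
def moveStep (κ : Kernel X X) (ν : Measure (Fin P → X)) : Measure (Fin P → X) :=
  ν.bind fun x => Measure.pi fun j => κ (x j)

/-- Law of the particles after a Re-weight and Re-sample step with weight function `G`: given the
present particles `x`, the new ones are independent draws from `Discrete({x_j}; {G (x_j)})`. -/
def resampleStep (G : X → ℝ≥0) (ν : Measure (Fin P → X)) : Measure (Fin P → X) :=
  ν.bind fun x => Measure.pi fun _ => discrete x fun j => G (x j)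

variable {𝓐 : Type*} [NormedAddCommGroup 𝓐]

/-- Law of the `P` particles `x^i` after `i` iterations Move, Re-weight, Re-sample,
started from `P` independent draws from `μ`. Iteration `i` uses the kernel `K i`. -/
def lawMoveFirst (φ : ℝ≥0 → ℝ≥0) (A : X → 𝓐) (a : 𝓐) (μ : Measure X) (δ : ℕ → ℝ≥0∞)
    (K : ℕ → Kernel X X) (P : ℕ) : ℕ → Measure (Fin P → X)
  | 0 => Measure.pi fun _ => μ
  | i + 1 => resampleStep (potential φ A a (δ i) (δ (i + 1)))
      (moveStep (K (i + 1)) (lawMoveFirst φ A a μ δ K P i))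

/-- The same with the steps taken in the order Re-weight, Re-sample, Move. -/
def lawMoveLast (φ : ℝ≥0 → ℝ≥0) (A : X → 𝓐) (a : 𝓐) (μ : Measure X) (δ : ℕ → ℝ≥0∞)
    (K : ℕ → Kernel X X) (P : ℕ) : ℕ → Measure (Fin P → X)
  | 0 => Measure.pi fun _ => μ
  | i + 1 => moveStep (K (i + 1))
      (resampleStep (potential φ A a (δ i) (δ (i + 1))) (lawMoveLast φ A a μ δ K P i))

end Particles

/-- All `κ x` are mutually absolutely continuous and `dκ(x,·)/dκ(y,·) ≥ ε` for all `x, y`. -/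
def UniformlyMinorised {X : Type*} [MeasurableSpace X] (κ : Kernel X X) (ε : ℝ≥0) : Prop :=
  ∀ x y, κ x ≪ κ y ∧ ∀ᵐ z ∂(κ y), (ε : ℝ≥0∞) ≤ (κ x).rnDeriv (κ y) z

/-- A tempering schedule `∞ = δ 0 > δ 1 > ⋯ > δ m > 0`. -/
structure IsSchedule (δ : ℕ → ℝ≥0∞) (m : ℕ) : Prop where
  zero_eq : δ 0 = ∞
  lt : ∀ i < m, δ (i + 1) < δ i
  pos : ∀ i ≤ m, 0 < δ i

/-- `E[|μ_P(f) - η(f)|^p]^{1/p} ≤ B`, where `μ_P` is the empirical distribution of `P` particles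
with joint law `ν` (with a finite `p`-th moment). -/
def LpErrorLE {X : Type*} [MeasurableSpace X] {P : ℕ} (ν : Measure (Fin P → X)) (η : Measure X)
    (f : X → ℝ) (p B : ℝ) : Prop :=
  Integrable (fun x => |∫ z, f z ∂(empirical x) - ∫ z, f z ∂η| ^ p) ν ∧
    (∫ x, |∫ z, f z ∂(empirical x) - ∫ z, f z ∂η| ^ p ∂ν) ^ (1 / p) ≤ B

end SMCND

end

/-!
Since `A` is bounded and `φ` is positive and decreasing, each weight `φ (‖A x - a‖ / δ)` lies in
`[c, 1]` for some `c > 0` that depends on `δ`, `A`, `a` and `φ` only. Hence every re-weighting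
factor is bounded below and at most `1`, and it is enough to follow the error through the finitely
many iterations, letting the constant grow from one to the next.

The quantity followed is the `p`-th absolute moment of the error of the particle average, for all
bounded measurable test functions at once (`MomentBound`). Both steps of the algorithm have the
same form: given the particles `x`, new particles are drawn independently from probability measures
`ρ x j`. The error of the new particles is the sum of a conditionally centred sampling error, and of
the error of the conditional mean `x ↦ P⁻¹ ∑ⱼ ∫ f d(ρ x j)`; see
`lintegral_bind_pi_abs_empMean_sub_rpow_le`.

* The sampling error is of order `P^(-1/2)` with a constant depending on `p` only. By Hoeffding's
  lemma the sum of the centred independent terms is sub-Gaussian, and `u ^ p ≤ ⌈p⌉! exp u` turns the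
  exponential moment into the `p`-th moment (`lintegral_pi_abs_empMean_sub_rpow_le`).
* For a move, the conditional mean is the old particle average of `κ f`, whose target value is that
  of `f` by invariance (`MomentBound.moveStep`).
* For re-sampling with weights `G` from the target `η` to `η'`, the conditional mean minus `η' f` is
  `∑ⱼ g (x j) / ∑ⱼ G (x j)` with `g = G (f - η' f)`. As `η g = 0` and `G ≥ c`, it is at most `c⁻¹`
  times the old error for `g` (`MomentBound.resampleStep`).
-/

namespace SMCND

/-! ### Moments of averages of independent draws -/

theorem measurable_measure_pi {Ω X : Type*} [MeasurableSpace Ω] [MeasurableSpace X] {P : ℕ}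
    {ρ : Ω → Fin P → Measure X} [∀ ω j, IsProbabilityMeasure (ρ ω j)]
    (hρ : ∀ j, Measurable fun ω => ρ ω j) :
    Measurable fun ω => Measure.pi (ρ ω) := by
  refine Measurable.measure_of_isPiSystem_of_isProbabilityMeasure generateFrom_pi.symm
    isPiSystem_pi ?_
  rintro _ ⟨s, hs, rfl⟩
  simp only [Measure.pi_pi]
  exact Finset.measurable_prod _ fun j _ => (Measure.measurable_coe (hs j trivial)).comp (hρ j)

section Moments

/-- The average of `f` over the particles `x` (equal to `0` when `P = 0`). -/
noncomputable def empMean {X : Type*} {P : ℕ} (f : X → ℝ) (x : Fin P → X) : ℝ := (∑ j, f (x j)) / P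

theorem measurable_empMean {X : Type*} [MeasurableSpace X] {P : ℕ} {f : X → ℝ}
    (hf : Measurable f) : Measurable (empMean f : (Fin P → X) → ℝ) := by
  unfold empMean
  fun_prop

theorem integral_empirical {X : Type*} [MeasurableSpace X] {P : ℕ} {f : X → ℝ}
    (hf : Measurable f) (x : Fin P → X) : ∫ z, f z ∂(empirical x) = empMean f x := by
  rw [empirical, integral_smul_measure, integral_finsetSum_measure]
  · simp [integral_dirac' _ _ hf.stronglyMeasurable, empMean, div_eq_inv_mul]
  · exact fun j _ => integrable_dirac' hf.stronglyMeasurable (by simp)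

theorem rpow_le_factorial_mul_exp {p u : ℝ} (hp : 0 ≤ p) (hu : 0 ≤ u) :
    u ^ p ≤ (⌈p⌉₊.factorial : ℝ) * Real.exp u := by
  have h1 : (1 : ℝ) ≤ ⌈p⌉₊.factorial := by exact_mod_cast Nat.factorial_pos _
  rcases le_total u 1 with h | h
  · calc u ^ p ≤ 1 := Real.rpow_le_one hu h hp
      _ ≤ _ := one_le_mul_of_one_le_of_one_le h1 (Real.one_le_exp hu)
  · calc u ^ p ≤ u ^ (⌈p⌉₊ : ℝ) := Real.rpow_le_rpow_of_exponent_le h (Nat.le_ceil p)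
      _ = u ^ ⌈p⌉₊ := Real.rpow_natCast _ _
      _ ≤ _ := by
        have := Real.pow_div_factorial_le_exp u hu ⌈p⌉₊
        rw [div_le_iff₀ (by positivity)] at this
        linarith

/-- The constant in the `p`-th moment bound for averages of independent draws. The factor
`2 exp (1 / 2)` bounds `E[exp |S|]` for a sub-Gaussian `S` with variance proxy `1`. -/
noncomputable def momentConst (p : ℝ) : ℝ := ⌈p⌉₊.factorial * (2 * Real.exp (1 / 2))

theorem momentConst_nonneg (p : ℝ) : 0 ≤ momentConst p := by unfold momentConst; positivity

theorem abs_integral_le_of_abs_le {X : Type*} [MeasurableSpace X] (ρ : Measure X)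
    [IsProbabilityMeasure ρ] {f : X → ℝ} {B : ℝ} (hfB : ∀ x, |f x| ≤ B) :
    |∫ x, f x ∂ρ| ≤ B := by
  simpa using norm_integral_le_of_norm_le_const (μ := ρ) (f := f) (ae_of_all _ hfB)

theorem integrable_of_abs_le {X : Type*} [MeasurableSpace X] (ρ : Measure X)
    [IsFiniteMeasure ρ] {f : X → ℝ} (hf : Measurable f) {B : ℝ} (hfB : ∀ x, |f x| ≤ B) :
    Integrable f ρ :=
  Integrable.of_bound hf.aestronglyMeasurable B (ae_of_all _ hfB)

/-- Marcinkiewicz–Zygmund type bound: the average of `f` over independent draws from the `ρ j`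
deviates from its expectation by `O(P^(-1/2))` in the `p`-th moment, with a constant that does not
depend on `P` or the `ρ j`. -/
theorem lintegral_pi_abs_empMean_sub_rpow_le {X : Type*} [MeasurableSpace X] {P : ℕ} (hP : 1 ≤ P)
    (ρ : Fin P → Measure X) [∀ j, IsProbabilityMeasure (ρ j)] {p : ℝ} (hp : 1 ≤ p)
    {f : X → ℝ} (hf : Measurable f) {B : ℝ} (hfB : ∀ x, |f x| ≤ B) :
    ∫⁻ y, ENNReal.ofReal (|empMean f y - (∑ j, ∫ z, f z ∂(ρ j)) / P| ^ p) ∂(Measure.pi ρ)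
      ≤ ENNReal.ofReal (momentConst p * (B / √P) ^ p) := by
  have hPpos : (0 : ℝ) < P := by exact_mod_cast hP
  have hB0 : 0 ≤ B := by
    obtain ⟨x⟩ : Nonempty X := (ρ ⟨0, hP⟩).nonempty_of_neZero
    exact (abs_nonneg _).trans (hfB x)
  -- the Laplace parameter chosen below is only available for `B > 0`
  rcases hB0.eq_or_lt with rfl | hB
  · have hf0 : ∀ x, f x = 0 := fun x => abs_nonpos_iff.1 (hfB x)
    simp [empMean, hf0, Real.zero_rpow (by linarith : p ≠ 0)]
  let g : Fin P → X → ℝ := fun j z => f z - ∫ z, f z ∂(ρ j)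
  have hg : ∀ j, Measurable (g j) := fun j => hf.sub_const _
  have hsub : ∀ j, HasSubgaussianMGF (fun y : Fin P → X => g j (y j)) (‖B‖₊ ^ 2)
      (Measure.pi ρ) := by
    intro j
    have h1 : HasSubgaussianMGF (g j) (‖B‖₊ ^ 2) (ρ j) := by
      have h := hasSubgaussianMGF_of_mem_Icc (μ := ρ j) hf.aemeasurable
        (ae_of_all _ fun x => abs_le.1 (hfB x))
      convert h using 2
      ext
      simp
      rw [← two_mul, abs_mul, abs_two, mul_div_cancel_left₀ _ two_ne_zero]
    rw [← (measurePreserving_eval ρ j).map_eq] at h1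
    exact h1.of_map (Y := Function.eval j) (μ := Measure.pi ρ) (measurable_pi_apply j).aemeasurable
  have hind : iIndepFun (fun j (y : Fin P → X) => g j (y j)) (Measure.pi ρ) :=
    iIndepFun_pi fun j => (hg j).aemeasurable
  have hsum := HasSubgaussianMGF.sum_of_iIndepFun hind (s := Finset.univ) fun j _ => hsub j
  set S : (Fin P → X) → ℝ := fun y => ∑ j, g j (y j) with hS
  -- at this value of the Laplace parameter the variance proxy `P * B ^ 2` is normalised to `1`
  set s : ℝ := (B * √P)⁻¹ with hs
  have hspos : 0 < s := by positivity
  have hvar : ((∑ j : Fin P, ‖B‖₊ ^ 2 : ℝ≥0) : ℝ) * s ^ 2 = 1 := by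
    simp only [Finset.sum_const, Finset.card_univ, Fintype.card_fin, nsmul_eq_mul, NNReal.coe_mul,
      NNReal.coe_natCast, NNReal.coe_pow, coe_nnnorm, Real.norm_eq_abs, sq_abs, hs, inv_pow,
      mul_pow, Real.sq_sqrt hPpos.le]
    field_simp
  have hexp : ∀ t, t ^ 2 = s ^ 2 →
      ∫⁻ y, ENNReal.ofReal (Real.exp (t * S y)) ∂(Measure.pi ρ)
        ≤ ENNReal.ofReal (Real.exp (1 / 2)) := by
    intro t ht
    rw [← ofReal_integral_eq_lintegral_ofReal (hsum.integrable_exp_mul t)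
      (ae_of_all _ fun _ => (Real.exp_pos _).le)]
    refine ENNReal.ofReal_le_ofReal ((hsum.mgf_le t).trans_eq ?_)
    rw [ht, hvar]
  have hpt : ∀ y : Fin P → X, |empMean f y - (∑ j, ∫ z, f z ∂(ρ j)) / P| ^ p
      ≤ (B / √P) ^ p * ⌈p⌉₊.factorial * (Real.exp (s * S y) + Real.exp (-s * S y)) := by
    intro y
    have h1 : empMean f y - (∑ j, ∫ z, f z ∂(ρ j)) / P = (B / √P) * (s * S y) := by
      have : √(P : ℝ) * √P = P := Real.mul_self_sqrt hPpos.le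
      simp only [empMean, hS, g, Finset.sum_sub_distrib, hs]
      field_simp
      rw [pow_two, this, mul_comm]
    rw [h1, abs_mul, abs_of_pos (by positivity : 0 < B / √P),
      Real.mul_rpow (by positivity) (abs_nonneg _), mul_assoc]
    refine mul_le_mul_of_nonneg_left ?_ (by positivity)
    refine (rpow_le_factorial_mul_exp (by linarith) (abs_nonneg _)).trans ?_
    refine mul_le_mul_of_nonneg_left ?_ (by positivity)
    rw [neg_mul]
    exact Real.exp_abs_le _
  have hSm : Measurable S := by
    refine Finset.measurable_sum _ fun j _ => (hg j).comp (measurable_pi_apply j)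
  calc _ ≤ ∫⁻ y, ENNReal.ofReal ((B / √P) ^ p * ⌈p⌉₊.factorial) *
        (ENNReal.ofReal (Real.exp (s * S y)) + ENNReal.ofReal (Real.exp (-s * S y)))
          ∂(Measure.pi ρ) := by
        refine lintegral_mono fun y => ?_
        rw [← ENNReal.ofReal_add (Real.exp_pos _).le (Real.exp_pos _).le,
          ← ENNReal.ofReal_mul (by positivity)]
        exact ENNReal.ofReal_le_ofReal (hpt y)
    _ ≤ ENNReal.ofReal ((B / √P) ^ p * ⌈p⌉₊.factorial) *
        (ENNReal.ofReal (Real.exp (1 / 2)) + ENNReal.ofReal (Real.exp (1 / 2))) := by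
        rw [lintegral_const_mul _ (by fun_prop), lintegral_add_left (by fun_prop)]
        gcongr
        · exact hexp s rfl
        · exact hexp (-s) (by ring)
    _ = _ := by
        rw [← ENNReal.ofReal_add (Real.exp_pos _).le (Real.exp_pos _).le,
          ← ENNReal.ofReal_mul (by positivity), momentConst]
        congr 1
        ring

/-- The triangle inequality through an intermediate value `b`, for `p`-th powers. -/
theorem ofReal_abs_sub_rpow_le (a b c : ℝ) {p : ℝ} (hp : 1 ≤ p) :
    ENNReal.ofReal (|a - c| ^ p)
      ≤ 2 ^ (p - 1) * (ENNReal.ofReal (|a - b| ^ p) + ENNReal.ofReal (|b - c| ^ p)) := by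
  have hp0 : 0 ≤ p := by linarith
  rw [← ENNReal.ofReal_rpow_of_nonneg (abs_nonneg _) hp0,
    ← ENNReal.ofReal_rpow_of_nonneg (abs_nonneg _) hp0,
    ← ENNReal.ofReal_rpow_of_nonneg (abs_nonneg _) hp0]
  refine le_trans ?_ (ENNReal.rpow_add_le_mul_rpow_add_rpow _ _ hp)
  refine ENNReal.rpow_le_rpow ?_ hp0
  rw [← ENNReal.ofReal_add (abs_nonneg _) (abs_nonneg _)]
  exact ENNReal.ofReal_le_ofReal (abs_sub_le a b c)

variable {X : Type*} [MeasurableSpace X] {P : ℕ}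

theorem isProbabilityMeasure_bind_pi (ν : Measure (Fin P → X)) [IsProbabilityMeasure ν]
    {ρ : (Fin P → X) → Fin P → Measure X} [∀ x j, IsProbabilityMeasure (ρ x j)]
    (hρ : ∀ j, Measurable fun x => ρ x j) :
    IsProbabilityMeasure (ν.bind fun x => Measure.pi (ρ x)) :=
  isProbabilityMeasure_bind (measurable_measure_pi hρ).aemeasurable
    (ae_of_all _ fun _ => inferInstance)

/-- Conditionally independent sampling: if, under `ν`, the conditional mean
`P⁻¹ ∑ⱼ ∫ f d(ρ x j)` is close to `e`, then so is the average of `f` over particles drawn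
independently from the `ρ x j`. -/
theorem lintegral_bind_pi_abs_empMean_sub_rpow_le (hP : 1 ≤ P) (ν : Measure (Fin P → X))
    [IsProbabilityMeasure ν] {ρ : (Fin P → X) → Fin P → Measure X}
    [∀ x j, IsProbabilityMeasure (ρ x j)] (hρ : ∀ j, Measurable fun x => ρ x j)
    {p : ℝ} (hp : 1 ≤ p) {f : X → ℝ} (hf : Measurable f) {B : ℝ} (hfB : ∀ x, |f x| ≤ B)
    (e : ℝ) {C : ℝ} (hC : 0 ≤ C)
    (h : ∫⁻ x, ENNReal.ofReal (|(∑ j, ∫ z, f z ∂(ρ x j)) / P - e| ^ p) ∂ν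
      ≤ ENNReal.ofReal (C * (B / √P) ^ p)) :
    ∫⁻ y, ENNReal.ofReal (|empMean f y - e| ^ p) ∂(ν.bind fun x => Measure.pi (ρ x))
      ≤ ENNReal.ofReal (2 ^ (p - 1) * (momentConst p + C) * (B / √P) ^ p) := by
  have hfm : Measurable (empMean f : (Fin P → X) → ℝ) := measurable_empMean hf
  have hB0 : 0 ≤ B := by
    obtain ⟨x⟩ : Nonempty (Fin P → X) := ν.nonempty_of_neZero
    exact (abs_nonneg _).trans (hfB (x ⟨0, hP⟩))
  rw [Measure.lintegral_bind (measurable_measure_pi hρ).aemeasurable (by fun_prop)]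
  calc _ ≤ ∫⁻ x, 2 ^ (p - 1) * (ENNReal.ofReal (momentConst p * (B / √P) ^ p) +
        ENNReal.ofReal (|(∑ j, ∫ z, f z ∂(ρ x j)) / P - e| ^ p)) ∂ν := by
        refine lintegral_mono fun x => ?_
        calc _ ≤ ∫⁻ y, 2 ^ (p - 1) *
              (ENNReal.ofReal (|empMean f y - (∑ j, ∫ z, f z ∂(ρ x j)) / P| ^ p) +
              ENNReal.ofReal (|(∑ j, ∫ z, f z ∂(ρ x j)) / P - e| ^ p)) ∂(Measure.pi (ρ x)) :=
              lintegral_mono fun y => ofReal_abs_sub_rpow_le _ _ _ hp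
          _ ≤ _ := by
              rw [lintegral_const_mul _ (by fun_prop), lintegral_add_right _ (by fun_prop),
                lintegral_const, measure_univ, mul_one]
              gcongr
              exact lintegral_pi_abs_empMean_sub_rpow_le hP (ρ x) hp hf hfB
    _ ≤ 2 ^ (p - 1) * (ENNReal.ofReal (momentConst p * (B / √P) ^ p) +
          ENNReal.ofReal (C * (B / √P) ^ p)) := by
        rw [lintegral_const_mul' _ _ (by simp), lintegral_add_left (by fun_prop),
          lintegral_const, measure_univ, mul_one]
        gcongr
    _ = _ := by
        have := momentConst_nonneg p
        rw [← ENNReal.ofReal_add (by positivity) (by positivity), ← add_mul,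
          mul_assoc (2 ^ (p - 1) : ℝ), ENNReal.ofReal_mul (p := 2 ^ (p - 1)) (by positivity),
          ← ENNReal.ofReal_rpow_of_pos two_pos, ENNReal.ofReal_ofNat]

/-! ### Propagation of the moment bound through the two steps -/

/-- The average over particles with joint law `ν` approximates the integral against `η`, with a
`p`-th moment of the error at most `C (B / √P) ^ p` for every measurable test function bounded
by `B`. Stated with the integral `∫⁻`, so that no integrability is presupposed. -/
def MomentBound (p C : ℝ) (ν : Measure (Fin P → X)) (η : Measure X) : Prop :=
  ∀ (f : X → ℝ) (B : ℝ), Measurable f → (∀ x, |f x| ≤ B) →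
    ∫⁻ x, ENNReal.ofReal (|empMean f x - ∫ z, f z ∂η| ^ p) ∂ν
      ≤ ENNReal.ofReal (C * (B / √P) ^ p)

theorem momentBound_pi (hP : 1 ≤ P) (μ : Measure X) [IsProbabilityMeasure μ] {p : ℝ}
    (hp : 1 ≤ p) : MomentBound p (momentConst p) (Measure.pi fun _ : Fin P => μ) μ := by
  intro f B hf hfB
  have h := lintegral_pi_abs_empMean_sub_rpow_le hP (fun _ : Fin P => μ) hp hf hfB
  have hP0 : (P : ℝ) ≠ 0 := by positivity
  simpa [mul_div_cancel_left₀ _ hP0] using h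

theorem measurable_kernel_comp_eval (κ : Kernel X X) (j : Fin P) :
    Measurable fun x : Fin P → X => κ (x j) :=
  κ.measurable.comp (measurable_pi_apply j)

theorem isProbabilityMeasure_moveStep (ν : Measure (Fin P → X)) [IsProbabilityMeasure ν]
    (κ : Kernel X X) [IsMarkovKernel κ] : IsProbabilityMeasure (moveStep κ ν) :=
  isProbabilityMeasure_bind_pi ν (measurable_kernel_comp_eval κ)

theorem integral_kernel_of_invariant {η : Measure X} {κ : Kernel X X}
    (hκ : κ.Invariant η) {f : X → ℝ} (hf : Integrable f η) :
    ∫ x, ∫ z, f z ∂(κ x) ∂η = ∫ z, f z ∂η := by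
  have hbind : (κ ∘ₖ Kernel.const Unit η) () = η := hκ.def
  have h := Kernel.integral_comp (η := κ) (κ := Kernel.const Unit η) (a := ()) (f := f)
    (by rwa [hbind])
  rw [hbind, Kernel.const_apply] at h
  exact h.symm

/-- Moving with a kernel that preserves the target `η` keeps the moment bound: the error splits into
the sampling error of the move and the error of `ν` on the averaged test function `κ f`. -/
theorem MomentBound.moveStep (hP : 1 ≤ P) {p C : ℝ} (hp : 1 ≤ p) (hC : 0 ≤ C)
    {ν : Measure (Fin P → X)} [IsProbabilityMeasure ν] {η : Measure X} [IsProbabilityMeasure η]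
    (h : MomentBound p C ν η) {κ : Kernel X X} [IsMarkovKernel κ] (hκ : κ.Invariant η) :
    MomentBound p (2 ^ (p - 1) * (momentConst p + C)) (moveStep κ ν) η := by
  intro f B hf hfB
  have hκf := h (fun x => ∫ z, f z ∂(κ x)) B hf.stronglyMeasurable.integral_kernel.measurable
    fun x => abs_integral_le_of_abs_le _ hfB
  rw [integral_kernel_of_invariant hκ (integrable_of_abs_le _ hf hfB)] at hκf
  exact lintegral_bind_pi_abs_empMean_sub_rpow_le hP ν (measurable_kernel_comp_eval κ) hp hf hfB
    _ hC hκf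

theorem sum_weights_pos (hP : 1 ≤ P) {w : Fin P → ℝ≥0} (hw : ∀ j, 0 < w j) : 0 < ∑ j, w j :=
  Finset.sum_pos (fun j _ => hw j) ⟨⟨0, hP⟩, Finset.mem_univ _⟩

theorem isProbabilityMeasure_discrete (hP : 1 ≤ P) (x : Fin P → X) {w : Fin P → ℝ≥0}
    (hw : ∀ j, 0 < w j) : IsProbabilityMeasure (discrete x w) := by
  constructor
  simp only [discrete, Measure.coe_finsetSum, Finset.sum_apply, Measure.smul_apply,
    measure_univ, smul_eq_mul, mul_one]
  rw [← ENNReal.ofNNReal_finsetSum, ← Finset.sum_div, div_self (sum_weights_pos hP hw).ne']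
  rfl

theorem integral_discrete {f : X → ℝ} (hf : Measurable f) (x : Fin P → X) (w : Fin P → ℝ≥0) :
    ∫ z, f z ∂(discrete x w) = (∑ j, (w j : ℝ) * f (x j)) / ∑ j, (w j : ℝ) := by
  rw [discrete, integral_finsetSum_measure]
  · simp [integral_dirac' _ _ hf.stronglyMeasurable, Finset.sum_div, NNReal.smul_def,
      div_mul_eq_mul_div, integral_smul_nnreal_measure]
  · exact fun j _ => (integrable_dirac' hf.stronglyMeasurable (by simp)).smul_measure (by simp)

theorem measurable_discrete {G : X → ℝ≥0} (hG : Measurable G) :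
    Measurable fun x : Fin P → X => discrete x fun j => G (x j) := by
  refine Measure.measurable_of_measurable_coe _ fun s hs => ?_
  simp only [discrete, Measure.coe_finsetSum, Finset.sum_apply, Measure.smul_apply, smul_eq_mul]
  refine Finset.measurable_sum _ fun j _ => Measurable.mul ?_ ?_
  · fun_prop
  · exact (Measure.measurable_coe hs).comp (Measure.measurable_dirac.comp (measurable_pi_apply j))

theorem isProbabilityMeasure_resampleStep (hP : 1 ≤ P) (ν : Measure (Fin P → X))
    [IsProbabilityMeasure ν] {G : X → ℝ≥0} (hG : Measurable G) (hG0 : ∀ x, 0 < G x) :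
    IsProbabilityMeasure (resampleStep G ν) := by
  have : ∀ x : Fin P → X, IsProbabilityMeasure (discrete x fun j => G (x j)) :=
    fun x => isProbabilityMeasure_discrete hP x fun j => hG0 _
  exact isProbabilityMeasure_bind_pi ν fun _ => measurable_discrete hG

/-- Re-sampling with weights `G ∈ [c, 1]` turns a moment bound for `η` into one for `η'`, where `η'`
is `η` re-weighted by `G` (hypothesis `hη`, with `Z` the mass of `G` under `η`). -/
theorem MomentBound.resampleStep (hP : 1 ≤ P) {p C : ℝ} (hp : 1 ≤ p) (hC : 0 ≤ C)
    {ν : Measure (Fin P → X)} [IsProbabilityMeasure ν] {η η' : Measure X}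
    [IsProbabilityMeasure η'] (h : MomentBound p C ν η)
    {G : X → ℝ≥0} (hG : Measurable G) {c : ℝ} (hc : 0 < c) (hcG : ∀ x, c ≤ G x)
    (hG1 : ∀ x, G x ≤ 1) {Z : ℝ}
    (hη : ∀ g : X → ℝ, ∫ x, (G x : ℝ) * g x ∂η = Z * ∫ x, g x ∂η') :
    MomentBound p (2 ^ (p - 1) * (momentConst p + C * (2 / c) ^ p)) (resampleStep G ν) η' := by
  intro f B hf hfB
  have hG0 : ∀ x, 0 < G x := fun x => by exact_mod_cast hc.trans_le (hcG x)
  have : ∀ x : Fin P → X, IsProbabilityMeasure (discrete x fun j => G (x j)) :=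
    fun x => isProbabilityMeasure_discrete hP x fun j => hG0 _
  have hPpos : (0 : ℝ) < P := by exact_mod_cast hP
  have hB0 : 0 ≤ B := by
    obtain ⟨x⟩ : Nonempty X := η'.nonempty_of_neZero
    exact (abs_nonneg _).trans (hfB x)
  refine lintegral_bind_pi_abs_empMean_sub_rpow_le hP ν (fun _ => measurable_discrete hG) hp hf hfB
    _ (by positivity) ?_
  set e : ℝ := ∫ z, f z ∂η' with he
  -- the centred, weighted test function has mean zero under `η`
  let g : X → ℝ := fun x => G x * (f x - e)
  have hg : Measurable g := by fun_prop
  have hgB : ∀ x, |g x| ≤ 2 * B := by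
    intro x
    have h1 : |f x - e| ≤ 2 * B :=
      (abs_sub _ _).trans (by linarith [hfB x, abs_integral_le_of_abs_le η' hfB])
    rw [abs_mul, NNReal.abs_eq]
    exact (mul_le_of_le_one_left (abs_nonneg _) (by exact_mod_cast hG1 x)).trans h1
  have hg0 : ∫ x, g x ∂η = 0 := by
    rw [hη, integral_sub (integrable_of_abs_le _ hf hfB) (integrable_const _)]
    simp [he]
  have key : ∀ x : Fin P → X,
      |(∑ j : Fin P, ∫ z, f z ∂(discrete x fun j => G (x j))) / P - e| ^ p
        ≤ c⁻¹ ^ p * |empMean g x - ∫ z, g z ∂η| ^ p := by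
    intro x
    rw [← Real.mul_rpow (by positivity) (abs_nonneg _), hg0, sub_zero]
    refine Real.rpow_le_rpow (abs_nonneg _) ?_ (by linarith)
    have hW : P * c ≤ ∑ j, (G (x j) : ℝ) := by
      simpa using Finset.card_nsmul_le_sum Finset.univ (fun j => (G (x j) : ℝ)) c fun j _ => hcG _
    have hWpos : 0 < ∑ j, (G (x j) : ℝ) := lt_of_lt_of_le (by positivity) hW
    have h1 : (∑ j : Fin P, ∫ z, f z ∂(discrete x fun j => G (x j))) / P - e
        = (∑ j, g (x j)) / ∑ j, (G (x j) : ℝ) := by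
      simp only [integral_discrete hf, Finset.sum_const, Finset.card_univ, Fintype.card_fin,
        nsmul_eq_mul, g, mul_sub, Finset.sum_sub_distrib, ← Finset.sum_mul]
      field_simp
    rw [h1, empMean, abs_div, abs_div, abs_of_pos hWpos, abs_of_pos hPpos, inv_mul_eq_div,
      div_div]
    exact div_le_div_of_nonneg_left (abs_nonneg _) (by positivity) hW
  calc _ ≤ ∫⁻ x, ENNReal.ofReal (c⁻¹ ^ p) *
        ENNReal.ofReal (|empMean g x - ∫ z, g z ∂η| ^ p) ∂ν := by
        refine lintegral_mono fun x => ?_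
        rw [← ENNReal.ofReal_mul (by positivity)]
        exact ENNReal.ofReal_le_ofReal (key x)
    _ ≤ ENNReal.ofReal (c⁻¹ ^ p) * ENNReal.ofReal (C * (2 * B / √P) ^ p) := by
        rw [lintegral_const_mul' _ _ (by simp)]
        gcongr
        exact h g (2 * B) hg hgB
    _ = _ := by
        rw [← ENNReal.ofReal_mul (by positivity)]
        congr 1
        rw [mul_left_comm, ← Real.mul_rpow (by positivity) (by positivity), mul_assoc,
          ← Real.mul_rpow (by positivity) (by positivity)]
        congr 2
        ring

theorem MomentBound.lpErrorLE {p C : ℝ} (hp : 1 ≤ p) (hC : 0 ≤ C)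
    {ν : Measure (Fin P → X)} [IsProbabilityMeasure ν] {η : Measure X} [IsProbabilityMeasure η]
    (h : MomentBound p C ν η) {f : X → ℝ} (hf : Measurable f) {B : ℝ} (hfB : ∀ x, |f x| ≤ B) :
    LpErrorLE ν η f p (C ^ (1 / p) * B / √P) := by
  have hp0 : 0 < p := by linarith
  have hB0 : 0 ≤ B := by
    obtain ⟨x⟩ : Nonempty X := η.nonempty_of_neZero
    exact (abs_nonneg _).trans (hfB x)
  have hm : Measurable fun x : Fin P → X => |empMean f x - ∫ z, f z ∂η| ^ p :=
    (((measurable_empMean hf).sub_const _).abs).pow_const p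
  have hnn : ∀ x : Fin P → X, 0 ≤ |empMean f x - ∫ z, f z ∂η| ^ p := fun x => by positivity
  have hb := h f B hf hfB
  have hint : Integrable (fun x : Fin P → X => |empMean f x - ∫ z, f z ∂η| ^ p) ν := by
    refine ⟨hm.aestronglyMeasurable, ?_⟩
    rw [hasFiniteIntegral_iff_ofReal (ae_of_all _ hnn)]
    exact hb.trans_lt ENNReal.ofReal_lt_top
  simp only [LpErrorLE, integral_empirical hf]
  refine ⟨hint, ?_⟩
  rw [← ofReal_integral_eq_lintegral_ofReal hint (ae_of_all _ hnn),
    ENNReal.ofReal_le_ofReal_iff (by positivity)] at hb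
  calc _ ≤ (C * (B / √P) ^ p) ^ (1 / p) :=
        Real.rpow_le_rpow (integral_nonneg hnn) hb (by positivity)
    _ = _ := by
        rw [Real.mul_rpow hC (by positivity), one_div, Real.rpow_rpow_inv (by positivity) hp0.ne',
          mul_div_assoc]

end Moments

/-! ### Relaxed distributions and the two orders of the steps -/

section Relaxed

variable {X : Type*} {𝓐 : Type*} [NormedAddCommGroup 𝓐] {φ : ℝ≥0 → ℝ≥0} {A : X → 𝓐} {a : 𝓐}

theorem weight_le_one (hφ : IsRelaxation φ) (a : 𝓐) (δ : ℝ≥0∞) (b : 𝓐) : weight φ a δ b ≤ 1 :=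
  (hφ.antitone zero_le).trans_eq hφ.map_zero

theorem weight_top (hφ : IsRelaxation φ) (a b : 𝓐) : weight φ a ∞ b = 1 := by
  simp [weight, hφ.map_zero]

/-- The one place where the boundedness of `A` and the positivity of `φ` enter jointly: on the range
of `A`, the weights are bounded away from `0`. -/
theorem exists_pos_le_weight (hφ : IsRelaxation φ) (hφ_pos : ∀ r, 0 < φ r)
    (hA_bdd : ∃ R : ℝ, ∀ x, ‖A x‖ ≤ R) (a : 𝓐) (δ : ℝ≥0∞) :
    ∃ c : ℝ, 0 < c ∧ ∀ x, c ≤ weight φ a δ (A x) := by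
  obtain ⟨R, hR⟩ := hA_bdd
  refine ⟨φ ((δ⁻¹).toNNReal * (R + ‖a‖).toNNReal), by exact_mod_cast hφ_pos _, fun x => ?_⟩
  refine NNReal.coe_le_coe.2 (hφ.antitone ?_)
  gcongr
  rw [← norm_toNNReal]
  exact Real.toNNReal_le_toNNReal ((norm_sub_le _ _).trans (by linarith [hR x]))

theorem potential_le_one (hφ : IsRelaxation φ) {δ δ' : ℝ≥0∞} (h : δ' ≤ δ) (h0 : 0 < δ') (x : X) :
    potential φ A a δ δ' x ≤ 1 := by
  refine div_le_one_of_le₀ (hφ.antitone ?_) zero_le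
  gcongr
  simpa using h0.ne'

theorem weight_le_potential (hφ : IsRelaxation φ) (hφ_pos : ∀ r, 0 < φ r) (δ δ' : ℝ≥0∞) (x : X) :
    weight φ a δ' (A x) ≤ potential φ A a δ δ' x :=
  le_div_self zero_le (hφ_pos _) (weight_le_one hφ a δ _)

variable [MeasurableSpace X] [MeasurableSpace 𝓐]

theorem normConst_ne_top (hφ : IsRelaxation φ) (hA : Measurable A)
    (a : 𝓐) (μ : Measure X) [IsProbabilityMeasure μ] (δ : ℝ≥0∞) : normConst φ A a μ δ ≠ ∞ := by
  have : IsProbabilityMeasure (μ.map A) := Measure.isProbabilityMeasure_map hA.aemeasurable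
  refine ((lintegral_mono (g := fun _ => 1) fun b => ?_).trans_lt ?_).ne
  · exact ENNReal.coe_le_one_iff.2 (weight_le_one hφ a δ b)
  · simp

theorem relaxed_top (hφ : IsRelaxation φ) (hA : Measurable A) (a : 𝓐) (μ : Measure X)
    [IsProbabilityMeasure μ] : relaxed φ A a μ ∞ = μ := by
  have : IsProbabilityMeasure (μ.map A) := Measure.isProbabilityMeasure_map hA.aemeasurable
  simp [relaxed, normConst, weight_top hφ]

variable [BorelSpace 𝓐]

theorem measurable_weight (hφ : IsRelaxation φ) (a : 𝓐) (δ : ℝ≥0∞) :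
    Measurable (weight φ a δ) := by
  have h : Measurable fun b : 𝓐 => (δ⁻¹).toNNReal * ‖b - a‖₊ :=
    (continuous_const.mul (continuous_id.sub continuous_const).nnnorm).measurable
  exact hφ.antitone.measurable.comp h

theorem measurable_potential (hφ : IsRelaxation φ) (hA : Measurable A) (a : 𝓐) (δ δ' : ℝ≥0∞) :
    Measurable (potential φ A a δ δ') :=
  ((measurable_weight hφ a δ').comp hA).div ((measurable_weight hφ a δ).comp hA)

theorem normConst_ne_zero (hφ : IsRelaxation φ) (hφ_pos : ∀ r, 0 < φ r) (hA : Measurable A)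
    (a : 𝓐) (μ : Measure X) [IsProbabilityMeasure μ] (δ : ℝ≥0∞) : normConst φ A a μ δ ≠ 0 := by
  have : IsProbabilityMeasure (μ.map A) := Measure.isProbabilityMeasure_map hA.aemeasurable
  rw [normConst, Ne, lintegral_eq_zero_iff (measurable_weight hφ a δ).coe_nnreal_ennreal]
  intro h
  obtain ⟨b, hb⟩ := h.exists
  exact (hφ_pos _).ne' (by simpa [weight] using hb)

theorem isProbabilityMeasure_relaxed (hφ : IsRelaxation φ) (hφ_pos : ∀ r, 0 < φ r)
    (hA : Measurable A) (a : 𝓐) (μ : Measure X) [IsProbabilityMeasure μ] (δ : ℝ≥0∞) :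
    IsProbabilityMeasure (relaxed φ A a μ δ) := by
  constructor
  have h : normConst φ A a μ δ = ∫⁻ x, (weight φ a δ (A x) : ℝ≥0∞) ∂μ :=
    lintegral_map (measurable_weight hφ a δ).coe_nnreal_ennreal hA
  rw [relaxed, Measure.smul_apply, withDensity_apply _ MeasurableSet.univ,
    Measure.restrict_univ, ← h, smul_eq_mul]
  exact ENNReal.inv_mul_cancel (normConst_ne_zero hφ hφ_pos hA a μ δ)
    (normConst_ne_top hφ hA a μ δ)

theorem integral_relaxed (hφ : IsRelaxation φ) (hA : Measurable A) (a : 𝓐) (μ : Measure X)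
    (δ : ℝ≥0∞) (g : X → ℝ) :
    ∫ x, g x ∂(relaxed φ A a μ δ)
      = (normConst φ A a μ δ)⁻¹.toReal * ∫ x, weight φ a δ (A x) * g x ∂μ := by
  rw [relaxed, integral_smul_measure,
    integral_withDensity_eq_integral_smul (f := fun x => weight φ a δ (A x))
      ((measurable_weight hφ a δ).comp hA)]
  rfl

/-- Re-weighting by the potential carries the relaxed distribution at `δ` to the one at `δ'`, up to
the ratio of the normalisation constants. -/
theorem integral_potential_mul_relaxed (hφ : IsRelaxation φ) (hφ_pos : ∀ r, 0 < φ r)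
    (hA : Measurable A) (a : 𝓐) (μ : Measure X) [IsProbabilityMeasure μ] (δ δ' : ℝ≥0∞)
    (g : X → ℝ) :
    ∫ x, (potential φ A a δ δ' x : ℝ) * g x ∂(relaxed φ A a μ δ)
      = ((normConst φ A a μ δ)⁻¹ * normConst φ A a μ δ').toReal *
        ∫ x, g x ∂(relaxed φ A a μ δ') := by
  have h : ∀ x, (weight φ a δ (A x) : ℝ) * (potential φ A a δ δ' x * g x)
      = weight φ a δ' (A x) * g x := by
    intro x
    have : (weight φ a δ (A x) : ℝ) ≠ 0 := by exact_mod_cast (hφ_pos _).ne'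
    rw [potential, NNReal.coe_div]
    field_simp
  simp only [integral_relaxed hφ hA, h]
  rw [ENNReal.toReal_mul, mul_assoc, ← mul_assoc (normConst φ A a μ δ').toReal,
    ← ENNReal.toReal_mul, ENNReal.mul_inv_cancel (normConst_ne_zero hφ hφ_pos hA a μ δ')
      (normConst_ne_top hφ hA a μ δ'), ENNReal.toReal_one, one_mul]

/-- The constant of the moment bound after `i` iterations Move, Re-weight, Re-sample, where `c i` is
a lower bound for the weights at the `i`-th bandwidth. -/
noncomputable def boundMoveFirst (p : ℝ) (c : ℕ → ℝ) : ℕ → ℝ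
  | 0 => momentConst p
  | i + 1 => 2 ^ (p - 1) * (momentConst p +
      2 ^ (p - 1) * (momentConst p + boundMoveFirst p c i) * (2 / c (i + 1)) ^ p)

/-- The constant of the moment bound after `i` iterations Re-weight, Re-sample, Move, where `c i` is
a lower bound for the weights at the `i`-th bandwidth. -/
noncomputable def boundMoveLast (p : ℝ) (c : ℕ → ℝ) : ℕ → ℝ
  | 0 => momentConst p
  | i + 1 => 2 ^ (p - 1) * (momentConst p +
      2 ^ (p - 1) * (momentConst p + boundMoveLast p c i * (2 / c (i + 1)) ^ p))

theorem boundMoveFirst_nonneg (p : ℝ) {c : ℕ → ℝ} (hc : ∀ i, 0 < c i) (i : ℕ) :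
    0 ≤ boundMoveFirst p c i := by
  have := momentConst_nonneg p
  induction i with
  | zero => exact this
  | succ i ih => have := hc (i + 1); unfold boundMoveFirst; positivity

theorem boundMoveLast_nonneg (p : ℝ) {c : ℕ → ℝ} (hc : ∀ i, 0 < c i) (i : ℕ) :
    0 ≤ boundMoveLast p c i := by
  have := momentConst_nonneg p
  induction i with
  | zero => exact this
  | succ i ih => have := hc (i + 1); unfold boundMoveLast; positivity

variable {m : ℕ} {δ : ℕ → ℝ≥0∞} {μ : Measure X} [IsProbabilityMeasure μ] {K : ℕ → Kernel X X}
  {P : ℕ} {p : ℝ} {c : ℕ → ℝ}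

theorem MomentBound.resampleStep_relaxed (hφ : IsRelaxation φ) (hφ_pos : ∀ r, 0 < φ r)
    (hA : Measurable A) {δ₀ δ₁ : ℝ≥0∞} (hle : δ₁ ≤ δ₀) (hpos : 0 < δ₁) {c : ℝ} (hc : 0 < c)
    (hcw : ∀ x, c ≤ weight φ a δ₁ (A x)) (hP : 1 ≤ P) (hp : 1 ≤ p) {C : ℝ} (hC : 0 ≤ C)
    {ν : Measure (Fin P → X)} [IsProbabilityMeasure ν]
    (h : MomentBound p C ν (relaxed φ A a μ δ₀)) :
    IsProbabilityMeasure (SMCND.resampleStep (potential φ A a δ₀ δ₁) ν) ∧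
      MomentBound p (2 ^ (p - 1) * (momentConst p + C * (2 / c) ^ p))
        (SMCND.resampleStep (potential φ A a δ₀ δ₁) ν) (relaxed φ A a μ δ₁) := by
  have := isProbabilityMeasure_relaxed hφ hφ_pos hA a μ δ₁
  have hcG : ∀ x, c ≤ potential φ A a δ₀ δ₁ x := fun x =>
    (hcw x).trans (NNReal.coe_le_coe.2 (weight_le_potential hφ hφ_pos δ₀ δ₁ x))
  have hG := measurable_potential hφ hA a δ₀ δ₁
  exact ⟨isProbabilityMeasure_resampleStep hP ν hG fun x => by exact_mod_cast hc.trans_le (hcG x),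
    h.resampleStep hP hp hC hG hc hcG (potential_le_one hφ hle hpos)
      (integral_potential_mul_relaxed hφ hφ_pos hA a μ δ₀ δ₁)⟩

theorem momentBound_lawMoveFirst (hφ : IsRelaxation φ) (hφ_pos : ∀ r, 0 < φ r)
    (hA : Measurable A) (hδ : IsSchedule δ m) (hc : ∀ i, 0 < c i)
    (hcw : ∀ i x, c i ≤ weight φ a (δ i) (A x)) (hP : 1 ≤ P) (hp : 1 ≤ p)
    (hK : ∀ i < m, IsMarkovKernel (K (i + 1)))
    (hinv : ∀ i < m, (K (i + 1)).Invariant (relaxed φ A a μ (δ i))) (i : ℕ) (hi : i ≤ m) :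
    IsProbabilityMeasure (lawMoveFirst φ A a μ δ K P i) ∧
      MomentBound p (boundMoveFirst p c i) (lawMoveFirst φ A a μ δ K P i)
        (relaxed φ A a μ (δ i)) := by
  have := fun i => isProbabilityMeasure_relaxed hφ hφ_pos hA a μ (δ i)
  induction i with
  | zero =>
    rw [hδ.zero_eq, relaxed_top hφ hA]
    exact ⟨by unfold lawMoveFirst; infer_instance, momentBound_pi hP μ hp⟩
  | succ i ih =>
    obtain ⟨_, h⟩ := ih (by omega)
    have := hK i hi
    have := isProbabilityMeasure_moveStep (lawMoveFirst φ A a μ δ K P i) (K (i + 1))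
    have h0 := boundMoveFirst_nonneg p hc i
    have h1 := momentConst_nonneg p
    exact (h.moveStep hP hp h0 (hinv i hi)).resampleStep_relaxed hφ hφ_pos hA (hδ.lt i hi).le
      (hδ.pos _ hi) (hc _) (hcw _) hP hp (by positivity)

theorem momentBound_lawMoveLast (hφ : IsRelaxation φ) (hφ_pos : ∀ r, 0 < φ r)
    (hA : Measurable A) (hδ : IsSchedule δ m) (hc : ∀ i, 0 < c i)
    (hcw : ∀ i x, c i ≤ weight φ a (δ i) (A x)) (hP : 1 ≤ P) (hp : 1 ≤ p)
    (hK : ∀ i < m, IsMarkovKernel (K (i + 1)))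
    (hinv : ∀ i < m, (K (i + 1)).Invariant (relaxed φ A a μ (δ (i + 1)))) (i : ℕ) (hi : i ≤ m) :
    IsProbabilityMeasure (lawMoveLast φ A a μ δ K P i) ∧
      MomentBound p (boundMoveLast p c i) (lawMoveLast φ A a μ δ K P i)
        (relaxed φ A a μ (δ i)) := by
  have := fun i => isProbabilityMeasure_relaxed hφ hφ_pos hA a μ (δ i)
  induction i with
  | zero =>
    rw [hδ.zero_eq, relaxed_top hφ hA]
    exact ⟨by unfold lawMoveLast; infer_instance, momentBound_pi hP μ hp⟩
  | succ i ih =>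
    obtain ⟨_, h⟩ := ih (by omega)
    have := hK i hi
    have h0 := boundMoveLast_nonneg p hc i
    have h1 := momentConst_nonneg p
    have hci := hc (i + 1)
    obtain ⟨_, h2⟩ := h.resampleStep_relaxed hφ hφ_pos hA (hδ.lt i hi).le
      (hδ.pos _ hi) hci (hcw _) hP hp h0
    exact ⟨isProbabilityMeasure_moveStep _ _,
      h2.moveStep hP hp (by positivity) (hinv i hi)⟩

end Relaxed

end SMCND

theorem mainTheorem5 {X : Type*} [MeasurableSpace X]
    {𝓐 : Type*} [NormedAddCommGroup 𝓐] [InnerProductSpace ℝ 𝓐] [CompleteSpace 𝓐]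
    [MeasurableSpace 𝓐] [BorelSpace 𝓐]
    -- the information operator, with bounded range, and the observed information
    (A : X → 𝓐) (hA : Measurable A) (hA_bdd : ∃ R : ℝ, ∀ x, ‖A x‖ ≤ R) (a : 𝓐)
    -- the relaxation function
    (φ : ℝ≥0 → ℝ≥0) (hφ : SMCND.IsRelaxation φ) (hφ_pos : ∀ r, 0 < φ r)
    -- the normed space of measurable functions, on which the norm dominates the sup norm
    (F : Submodule ℝ (X → ℝ)) (hF : ∀ f ∈ F, Measurable f) (normF : Seminorm ℝ F)
    (CF : ℝ) (hnormF : ∀ (f : F) (x : X), |(f : X → ℝ) x| ≤ CF * normF f)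
    -- the tempering schedule, the minorisation constants and the exponent
    (m : ℕ) (δ : ℕ → ℝ≥0∞) (hδ : SMCND.IsSchedule δ m)
    (ε : ℕ → ℝ≥0) (hε : ∀ i < m, 0 < ε i) (p : ℝ) (hp : 1 ≤ p) :
    ∃ C : ℝ, ∀ (μ : Measure X) [IsProbabilityMeasure μ] (K : ℕ → Kernel X X),
      (∀ i < m, IsMarkovKernel (K (i + 1))) →
      (∀ i < m, SMCND.UniformlyMinorised (K (i + 1)) (ε i)) →
      -- order Move, Re-weight, Re-sample, where a Move preserves the current target
      ((∀ i < m, (K (i + 1)).Invariant (SMCND.relaxed φ A a μ (δ i))) →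
        ∀ P : ℕ, 1 ≤ P → ∀ i ≤ m, ∀ f : F,
          SMCND.LpErrorLE (SMCND.lawMoveFirst φ A a μ δ K P i) (SMCND.relaxed φ A a μ (δ i))
            f p (C * normF f / √P)) ∧
      -- order Re-weight, Re-sample, Move, where a Move preserves the new target
      ((∀ i < m, (K (i + 1)).Invariant (SMCND.relaxed φ A a μ (δ (i + 1)))) →
        ∀ P : ℕ, 1 ≤ P → ∀ i ≤ m, ∀ f : F,
          SMCND.LpErrorLE (SMCND.lawMoveLast φ A a μ δ K P i) (SMCND.relaxed φ A a μ (δ i))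
            f p (C * normF f / √P)) := by
  choose c hc hcw using fun i => SMCND.exists_pos_le_weight hφ hφ_pos hA_bdd a (δ i)
  have hF0 := SMCND.boundMoveFirst_nonneg p hc
  have hL0 := SMCND.boundMoveLast_nonneg p hc
  -- summing over the iterations and both orders gives one constant for all of them
  set D : ℝ := ∑ i ∈ Finset.range (m + 1),
    (SMCND.boundMoveFirst p c i ^ (1 / p) + SMCND.boundMoveLast p c i ^ (1 / p)) with hD
  have hterm : ∀ i ≤ m,
      SMCND.boundMoveFirst p c i ^ (1 / p) + SMCND.boundMoveLast p c i ^ (1 / p) ≤ D := by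
    intro i hi
    refine Finset.single_le_sum (f := fun i =>
      SMCND.boundMoveFirst p c i ^ (1 / p) + SMCND.boundMoveLast p c i ^ (1 / p))
      (fun i _ => ?_) (Finset.mem_range.2 (by omega))
    have := hF0 i
    have := hL0 i
    positivity
  refine ⟨D * CF, fun μ _ K hK _ => ?_⟩
  have := fun i => SMCND.isProbabilityMeasure_relaxed hφ hφ_pos hA a μ (δ i)
  obtain ⟨x₀⟩ : Nonempty X := μ.nonempty_of_neZero
  have hB0 : ∀ f : F, 0 ≤ CF * normF f := fun f => (abs_nonneg _).trans (hnormF f x₀)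
  constructor
  · intro hinv P hP i hi f
    obtain ⟨_, h⟩ := SMCND.momentBound_lawMoveFirst (p := p) hφ hφ_pos hA hδ hc hcw hP hp hK hinv
      i hi
    obtain ⟨h1, h2⟩ := h.lpErrorLE hp (hF0 i) (hF f f.2) (hnormF f)
    refine ⟨h1, h2.trans ?_⟩
    rw [mul_assoc D]
    have := hB0 f
    gcongr
    linarith [hterm i hi, Real.rpow_nonneg (hL0 i) (1 / p)]
  · intro hinv P hP i hi f
    obtain ⟨_, h⟩ := SMCND.momentBound_lawMoveLast (p := p) hφ hφ_pos hA hδ hc hcw hP hp hK hinv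
      i hi
    obtain ⟨h1, h2⟩ := h.lpErrorLE hp (hL0 i) (hF f f.2) (hnormF f)
    refine ⟨h1, h2.trans ?_⟩
    rw [mul_assoc D]
    have := hB0 f
    gcongr
    linarith [hterm i hi, Real.rpow_nonneg (hF0 i) (1 / p)]
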